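/- For $p\in\mathbb R$, $p\neq -n$, and integers $m,k\ge 0$, the $L_p$ Steiner coefficients and the $L_p$-Steiner quermassintegrals of a convex body $K$ (compact, convex, with nonempty interior) in $\mathbb R^n$ are $$\mathcal W^p_{m,k}(K)=\int_{\partial K}\langle x,N(x)\rangle^{m-k+\frac{n(1-p)}{n+p}}\,H_{n-1}^{\frac p{n+p}}\sum_{\substack{i_1,\dots,i_{n-1}\ge 0\\ i_1+2i_2+\dots+(n-1)i_{n-1}=m}} c(n,p,i)\prod_{j=1}^{n-1}\binom{n-1}{j}^{i_j}H_j^{i_j}\,d\mathcal H^{n-1},\qquad \mathcal V^p_k(K)=\sum_{m=0}^k\binom{\frac{n(1-p)}{n+p}}{k-m}\mathcal W^p_{m,k}(K),$$ where $c(n,p,i)=\binom{n/(n+p)}{i_1+\dots+i_{n-1}}\binom{i_1+\dots+i_{n-1}}{i_1,\dots,i_{n-1}}$ (a generalized binomial times a multinomial coefficient), $N(x)$ is the outer unit normal of $K$ at $x\in\partial K$, $\mathcal H^{n-1}$ is the surface area measure, and $H_j$ is the $j$-th normalized elementary symmetric function of the (generalized) principal curvatures of $\partial K$. Terms of $\mathcal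 V^p_k$ with vanishing binomial coefficient are read as $0$. Let $\mathcal C^n$ be the class of convex bodies $K\subset\mathbb R^n$ that contain the origin and admit an inner and an outer rolling ball, i.e. there are $r,R>0$ such that $B(x-rN(x),r)\subseteq K\subseteq B(x-RN(x),R)$ for all $x\in\partial K$. **Corollary.** Let $K\in\mathcal C^n$ and let $k\ge 0$ be an integer. Then $\mathcal V^1_k(K)=\mathcal W^1_{k,k}(K)=:\mathcal W_{k,k}(K)$, and $\mathcal W_{k,k}(g(K))$ is given by an absolutely convergent integral for every rigid motion $g$ of $\mathbb R^n$; if the origin is an interior point of $K$, then so is $\mathcal W^1_{m,k}(K)$ for every $0\le m\le k$. Moreover: (i) $\mathcal V^1_k=\mathcal W_{k,k}$ is invariant under rigid motions: for every isometry $g$ of $\mathbb R^n$ (translations, rotations and reflections included), $\mathcal V^1_k(g(K))=\mathcal V^1_k(K)$ and $\mathcal W_{k,k}(g(K))=\mathcal W_{k,k}(K)$. (ii) $\mathcal V^1_k=\mathcal W_{k,k}$ is homogeneous of degree $n\frac{n-1}{n+1}-k$: for every $t>0$, $\mathcal V^1_k(tK)=t^{\,n\frac{n-1}{n+1}-k}\,\mathcal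 V^1_k(K)$ and $\mathcal W_{k,k}(tK)=t^{\,n\frac{n-1}{n+1}-k}\,\mathcal W_{k,k}(K)$. -/

import Mathlib

open scoped Pointwise RealInnerProductSpace Topology MeasureTheory

noncomputable section

namespace LpSteiner

/-- The Euclidean space `ℝⁿ`. -/
abbrev Eucl (n : ℕ) : Type := EuclideanSpace ℝ (Fin n)

variable {n : ℕ}

/-- Convex bodies: compact convex sets with nonempty interior. -/
def IsBody (K : Set (Eucl n)) : Prop :=
  IsCompact K ∧ Convex ℝ K ∧ (interior K).Nonempty

/-- `N` is an outer unit normal vector of `K` at `x`. -/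
def IsOuterUnitNormal (K : Set (Eucl n)) (x N : Eucl n) : Prop :=
  ‖N‖ = 1 ∧ ∀ y ∈ K, ⟪y - x, N⟫ ≤ 0

/-- `K` admits an inner rolling ball. -/
def AdmitsInnerRollingBall (K : Set (Eucl n)) : Prop :=
  ∃ r : ℝ, 0 < r ∧ ∀ x ∈ frontier K, ∀ N, IsOuterUnitNormal K x N →
    Metric.closedBall (x - r • N) r ⊆ K

/-- `K` admits an outer rolling ball. -/
def AdmitsOuterRollingBall (K : Set (Eucl n)) : Prop :=
  ∃ R : ℝ, 0 < R ∧ ∀ x ∈ frontier K, ∀ N, IsOuterUnitNormal K x N →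
    K ⊆ Metric.closedBall (x - R • N) R

/-- The class of convex bodies in `ℝⁿ` that contain the origin and admit an inner and an outer
rolling ball. -/
def rollingClass (n : ℕ) : Set (Set (Eucl n)) :=
  {K | IsBody K ∧ 0 ∈ K ∧ AdmitsInnerRollingBall K ∧ AdmitsOuterRollingBall K}

open Classical in
/-- The outer unit normal `N(x)` of `K` at `x`. It is unique at almost every boundary point of a
convex body, and at every boundary point of a body that admits an inner rolling ball. -/
def outerNormal (K : Set (Eucl n)) (x : Eucl n) : Eucl n :=
  if h : ∃ N, IsOuterUnitNormal K x N then h.choose else 0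

/-- `A` is the (generalized) Weingarten map of `∂K` at `x` with respect to the outer unit normal
`N`, extended by `A N = 0` from the tangent space `N^⊥` to the whole space. That is, `∂K` is near
`x` the graph over the tangent hyperplane of a function that has at `x` the second order Taylor
expansion `½ ⟪A v, v⟫ + o(‖v‖²)`: the distance of `y ∈ ∂K` from the tangent hyperplane at `x` is
`⟪x - y, N⟫`, and `⟪A (y - x), y - x⟫` only sees the tangential part of `y - x`. -/
def IsWeingartenMap (K : Set (Eucl n)) (x N : Eucl n) (A : Eucl n →ₗ[ℝ] Eucl n) : Prop :=
  A.IsSymmetric ∧ A N = 0 ∧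
    (fun y => ⟪x - y, N⟫ - (1 / 2) * ⟪A (y - x), y - x⟫)
      =o[𝓝[frontier K] x] (fun y => ‖y - x‖ ^ 2)

open Classical in
/-- The Weingarten map of `∂K` at `x` (`0` where it does not exist, a null set for convex
bodies). -/
def weingarten (K : Set (Eucl n)) (x : Eucl n) : Eucl n →ₗ[ℝ] Eucl n :=
  if h : ∃ A, IsWeingartenMap K x (outerNormal K x) A then h.choose else 0

/-- The `n - 1` principal curvatures of `∂K` at `x`, with multiplicity: the eigenvalues of the
Weingarten map, without the one eigenvalue `0` that belongs to the normal direction. -/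
def principalCurvatures (K : Set (Eucl n)) (x : Eucl n) : Multiset ℝ :=
  (weingarten K x).charpoly.roots.erase 0

/-- The `j`-th normalized elementary symmetric function `H_j` of the principal curvatures. -/
def symCurv (K : Set (Eucl n)) (j : ℕ) (x : Eucl n) : ℝ :=
  ((n - 1).choose j : ℝ)⁻¹ * (principalCurvatures K x).esymm j

/-- All `(i_1, …, i_{n-1})` of natural numbers with `i_1 + 2 i_2 + ⋯ + (n-1) i_{n-1} = m`; the
entry with index `j : Fin (n - 1)` is `i_{j+1}`. -/
def indices (n m : ℕ) : Finset (Fin (n - 1) → ℕ) :=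
  (Fintype.piFinset fun _ => Finset.range (m + 1)).filter
    fun i => ∑ j : Fin (n - 1), ((j : ℕ) + 1) * i j = m

/-- `c(n, p, i) = binom(n/(n+p), i_1+⋯+i_{n-1}) * multinomial(i_1, …, i_{n-1})`. -/
def coeff (n : ℕ) (p : ℝ) (i : Fin (n - 1) → ℕ) : ℝ :=
  Ring.choose ((n : ℝ) / (n + p)) (∑ j, i j) * (Nat.multinomial Finset.univ i : ℝ)

/-- The integrand of the `L_p` Steiner coefficient `W^p_{m,k}(K)`. -/
def steinerIntegrand (p : ℝ) (m k : ℕ) (K : Set (Eucl n)) (x : Eucl n) : ℝ :=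
  ⟪x, outerNormal K x⟫ ^ ((m : ℝ) - k + n * (1 - p) / (n + p)) *
    symCurv K (n - 1) x ^ (p / (n + p)) *
    ∑ i ∈ indices n m, coeff n p i *
      ∏ j : Fin (n - 1),
        ((n - 1).choose ((j : ℕ) + 1) : ℝ) ^ i j * symCurv K ((j : ℕ) + 1) x ^ i j

/-- The surface area measure on `∂K`: the restriction of the `(n-1)`-dimensional Hausdorff measure,
normalized so as to agree with Lebesgue measure on `ℝⁿ⁻¹`. -/
def boundaryMeasure (K : Set (Eucl n)) : MeasureTheory.Measure (Eucl n) :=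
  (μHE[n - 1]).restrict (frontier K)

/-- The `L_p` Steiner coefficients `W^p_{m,k}(K)`. -/
def steinerCoeff (p : ℝ) (m k : ℕ) (K : Set (Eucl n)) : ℝ :=
  ∫ x, steinerIntegrand p m k K x ∂(boundaryMeasure K)

/-- The `L_p`-Steiner quermassintegrals `V^p_k(K)`. -/
def quermass (p : ℝ) (k : ℕ) (K : Set (Eucl n)) : ℝ :=
  ∑ m ∈ Finset.range (k + 1),
    Ring.choose ((n : ℝ) * (1 - p) / (n + p)) (k - m) * steinerCoeff p m k K

end LpSteiner

end

/-! At `p = 1` the upper binomial argument `n(1-p)/(n+p)` is `0`, so only `m = k` survives in the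
quermassintegral. There the exponent of the support function `⟪x, N⟫` is `0` too, so the integrand
depends on the curvatures alone and not on the origin.

A similarity with ratio `t` and linear part `L` sends `N` to `L N` and the Weingarten map `A` to
`t⁻¹ L A L⁻¹`. Hence `H_j` scales by `t^(-j)`, each term of the weighted sum by `t^(-k)`,
`H_{n-1}^(1/(n+1))` by `t^(-(n-1)/(n+1))`, and area by `t^(n-1)`. Rigid motions have `t = 1`; for
dilations the exponents add up to the stated degree.

Normal and Weingarten map are defined by choice, so the transformation rules need uniqueness, which
the inner ball supplies together with the bound `‖A‖ ≤ 2/r`. For integrability, each `H_j` is a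
polynomial in the entries of `A`, `A` is measurable because its graph is Borel, and the boundary has
finite area because the nearest point map contracts a cube surface onto it. -/

noncomputable section

namespace LpSteiner

variable {n : ℕ}

/-! ### Outer normals of bodies with an inner rolling ball -/

/-- Convex bodies along whose boundary a ball of radius `r` rolls freely inside. -/
structure HasInnerBall (K : Set (Eucl n)) (r : ℝ) : Prop where
  body : IsBody K
  pos : 0 < r
  ball : ∀ x ∈ frontier K, ∀ N, IsOuterUnitNormal K x N → Metric.closedBall (x - r • N) r ⊆ K

theorem HasInnerBall.of_mem_rollingClass {K : Set (Eucl n)} (hK : K ∈ rollingClass n) :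
    ∃ r, HasInnerBall K r := by
  obtain ⟨hb, -, ⟨r, hr, h⟩, -⟩ := hK
  exact ⟨r, hb, hr, h⟩

theorem IsBody.exists_isOuterUnitNormal {K : Set (Eucl n)} (hK : IsBody K) {x : Eucl n}
    (hx : x ∈ frontier K) : ∃ N, IsOuterUnitNormal K x N := by
  obtain ⟨hc, hconv, hint⟩ := hK
  obtain ⟨f, hf⟩ := geometric_hahn_banach_open_point hconv.interior isOpen_interior hx.2
  obtain ⟨u, rfl⟩ := (InnerProductSpace.toDual ℝ (Eucl n)).surjective f
  simp only [InnerProductSpace.toDual_apply_apply] at hf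
  have hu : u ≠ 0 := by
    rintro rfl
    obtain ⟨a, ha⟩ := hint
    simpa using hf a ha
  have hle : ∀ y ∈ K, ⟪u, y⟫ ≤ ⟪u, x⟫ := by
    intro y hy
    have hy' : y ∈ closure (interior K) := by
      rw [hconv.closure_interior_eq_closure_of_nonempty_interior hint]
      exact subset_closure hy
    have hcl : IsClosed {y : Eucl n | ⟪u, y⟫ ≤ ⟪u, x⟫} :=
      isClosed_le (by fun_prop) continuous_const
    exact closure_minimal (fun z hz => (hf z hz).le) hcl hy'
  refine ⟨‖u‖⁻¹ • u, ?_, fun y hy => ?_⟩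
  · rw [norm_smul, norm_inv, norm_norm, inv_mul_cancel₀ (norm_ne_zero_iff.2 hu)]
  · rw [inner_smul_right, inner_sub_left, real_inner_comm u y, real_inner_comm u x]
    have := hle y hy
    have h2 : 0 ≤ ‖u‖⁻¹ := by positivity
    nlinarith

theorem IsBody.frontier_subset {K : Set (Eucl n)} (hK : IsBody K) : frontier K ⊆ K :=
  hK.1.isClosed.frontier_subset

theorem HasInnerBall.add_smul_mem {K : Set (Eucl n)} {r : ℝ} (hK : HasInnerBall K r)
    {x N : Eucl n} (hx : x ∈ frontier K) (hN : IsOuterUnitNormal K x N) {v : Eucl n}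
    (hv : ‖v‖ ≤ 1) : x - r • N + r • v ∈ K := by
  apply hK.ball x hx N hN
  rw [Metric.mem_closedBall, dist_eq_norm, add_sub_cancel_left, norm_smul, Real.norm_eq_abs,
    abs_of_pos hK.pos]
  nlinarith [hK.pos]

/-- The outer unit normal is a Lipschitz function of the boundary point. -/
theorem HasInnerBall.norm_normal_sub_le {K : Set (Eucl n)} {r : ℝ} (hK : HasInnerBall K r)
    {x x' N N' : Eucl n} (hx : x ∈ frontier K) (hN : IsOuterUnitNormal K x N)
    (hx' : x' ∈ frontier K) (hN' : IsOuterUnitNormal K x' N') :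
    r * ‖N - N'‖ ≤ ‖x - x'‖ := by
  -- The inner ball at `x` contains its extreme point in direction `N'`, which the supporting
  -- half-space at `x'` bounds; then the same with roles exchanged. The sum of the two is `h3`.
  have h1 := hN'.2 _ (hK.add_smul_mem hx hN (v := N') hN'.1.le)
  have h2 := hN.2 _ (hK.add_smul_mem hx' hN' (v := N) hN.1.le)
  have e1 : ⟪N, N⟫ = 1 := by rw [real_inner_self_eq_norm_sq, hN.1]; norm_num
  have e2 : ⟪N', N'⟫ = 1 := by rw [real_inner_self_eq_norm_sq, hN'.1]; norm_num
  have h3 : r * ‖N - N'‖ ^ 2 ≤ ⟪x - x', N - N'⟫ := by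
    rw [← real_inner_self_eq_norm_sq]
    simp only [inner_sub_left, inner_sub_right, inner_add_left, inner_smul_left, e1, e2,
      real_inner_comm N N', RCLike.conj_to_real] at h1 h2 ⊢
    linarith
  have h4 := real_inner_le_norm (x - x') (N - N')
  rcases (norm_nonneg (N - N')).eq_or_lt with h | h
  · rw [← h]; simp
  · nlinarith

theorem HasInnerBall.normal_unique {K : Set (Eucl n)} {r : ℝ} (hK : HasInnerBall K r)
    {x N N' : Eucl n} (hx : x ∈ frontier K) (hN : IsOuterUnitNormal K x N)
    (hN' : IsOuterUnitNormal K x N') : N = N' := by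
  have h := hK.norm_normal_sub_le hx hN hx hN'
  rw [sub_self, norm_zero] at h
  have : ‖N - N'‖ ≤ 0 := by
    by_contra! hc
    nlinarith [hK.pos]
  exact sub_eq_zero.1 (norm_le_zero_iff.1 this)

theorem IsBody.outerNormal_spec {K : Set (Eucl n)} (hK : IsBody K)
    {x : Eucl n} (hx : x ∈ frontier K) : IsOuterUnitNormal K x (outerNormal K x) := by
  have h := hK.exists_isOuterUnitNormal hx
  rw [outerNormal, dif_pos h]
  exact h.choose_spec

theorem HasInnerBall.continuousOn_outerNormal {K : Set (Eucl n)} {r : ℝ}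
    (hK : HasInnerBall K r) : ContinuousOn (outerNormal K) (frontier K) := by
  have : LipschitzOnWith (Real.toNNReal r⁻¹) (outerNormal K) (frontier K) := by
    refine LipschitzOnWith.of_dist_le_mul fun x hx y hy => ?_
    rw [dist_eq_norm, dist_eq_norm, Real.coe_toNNReal _ (inv_nonneg.2 hK.pos.le)]
    have := hK.norm_normal_sub_le hx (hK.body.outerNormal_spec hx) hy (hK.body.outerNormal_spec hy)
    rw [← div_eq_inv_mul, le_div_iff₀ hK.pos]
    linarith
  exact this.continuousOn

/-! ### Uniqueness and boundedness of the Weingarten map -/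

/-- A normal section of the boundary: above the tangent vector `v` there is a boundary point. -/
theorem HasInnerBall.exists_mem_frontier {K : Set (Eucl n)} {r : ℝ} (hK : HasInnerBall K r)
    {x N v : Eucl n} (hx : x ∈ frontier K) (hN : IsOuterUnitNormal K x N) (hv : ⟪v, N⟫ = 0)
    (hvr : ‖v‖ ≤ r) : ∃ s, 0 ≤ s ∧ s ≤ ‖v‖ ^ 2 / r ∧ x + v - s • N ∈ frontier K := by
  have hr := hK.pos
  have e1 : ⟪N, N⟫ = 1 := by rw [real_inner_self_eq_norm_sq, hN.1]; norm_num
  -- At depth `S` the point is inside the rolling ball: `‖v‖² + (r - S)² ≤ r²` amounts to `S ≤ ‖v‖`,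
  -- since `S r = ‖v‖²`.
  set S := ‖v‖ ^ 2 / r with hS
  have hS0 : 0 ≤ S := by positivity
  have hSr : S * r = ‖v‖ ^ 2 := div_mul_cancel₀ _ hr.ne'
  have hSv : S ≤ ‖v‖ := by
    rw [hS, div_le_iff₀ hr]; nlinarith [norm_nonneg v]
  have hin : x + v - S • N ∈ K := by
    apply hK.ball x hx N hN
    rw [Metric.mem_closedBall, dist_eq_norm]
    have : x + v - S • N - (x - r • N) = v + (r - S) • N := by module
    rw [this]
    refine (sq_le_sq₀ (norm_nonneg _) hr.le).1 ?_
    rw [norm_add_sq_real, inner_smul_right, hv, norm_smul, mul_pow, hN.1, Real.norm_eq_abs, sq_abs]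
    nlinarith
  have hout : x + v ∉ interior K := by
    intro hi
    obtain ⟨ε, hε, hb⟩ := Metric.isOpen_iff.1 isOpen_interior _ hi
    have hm : x + v + (ε / 2) • N ∈ K := by
      apply interior_subset (hb _)
      rw [Metric.mem_ball, dist_eq_norm, add_sub_cancel_left, norm_smul, hN.1, Real.norm_eq_abs,
        abs_of_pos (by positivity)]
      linarith
    have := hN.2 _ hm
    rw [add_assoc, add_sub_cancel_left, inner_add_left, hv, inner_smul_left, e1] at this
    simp at this
    linarith
  let γ : ℝ → Eucl n := fun s => x + v - s • N
  have hγ : Continuous γ := by fun_prop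
  by_cases hmem : x + v ∈ K
  · exact ⟨0, le_rfl, hS0, by simpa using ⟨subset_closure hmem, hout⟩⟩
  -- A segment from outside `K` to a point of `K` that missed the frontier would be separated by the
  -- interior and the complement.
  have hpre : IsPreconnected (γ '' Set.Icc 0 S) := isPreconnected_Icc.image _ hγ.continuousOn
  by_contra! hno
  have hcl := hK.body.1.isClosed
  have hfr : ∀ s ∈ Set.Icc 0 S, γ s ∈ K → γ s ∈ interior K := fun s hs hsK => by
    by_contra hi
    exact hno s hs.1 hs.2 ⟨subset_closure hsK, hi⟩
  obtain ⟨y, -, hy⟩ := hpre (interior K) Kᶜ isOpen_interior hcl.isOpen_compl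
    (by
      rintro _ ⟨s, hs, rfl⟩
      by_cases h : γ s ∈ K
      exacts [Or.inl (hfr s hs h), Or.inr h])
    ⟨γ S, ⟨S, ⟨hS0, le_rfl⟩, rfl⟩, hfr S ⟨hS0, le_rfl⟩ hin⟩
    ⟨γ 0, ⟨0, ⟨le_rfl, hS0⟩, rfl⟩, by simpa [γ] using hmem⟩
  exact hy.2 (interior_subset hy.1)

/-- The second fundamental form is a limit of difference quotients that do not depend on the
Weingarten map. -/
theorem HasInnerBall.exists_tendsto_quadratic {K : Set (Eucl n)} {r : ℝ} (hK : HasInnerBall K r)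
    {x N v : Eucl n} (hx : x ∈ frontier K) (hN : IsOuterUnitNormal K x N) (hv : ⟪v, N⟫ = 0) :
    ∃ q : ℝ → ℝ, (∀ᶠ t in 𝓝[>] (0 : ℝ), q t ∈ Set.Icc 0 (2 * ‖v‖ ^ 2 / r)) ∧
      ∀ A, IsWeingartenMap K x N A → Filter.Tendsto q (𝓝[>] 0) (𝓝 ⟪A v, v⟫) := by
  have hr := hK.pos
  have e1 : ⟪N, N⟫ = 1 := by rw [real_inner_self_eq_norm_sq, hN.1]; norm_num
  have hsmall : ∀ᶠ t in 𝓝[>] (0 : ℝ), 0 < t ∧ ‖t • v‖ ≤ r := by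
    refine (eventually_mem_nhdsWithin).and (Filter.Eventually.filter_mono nhdsWithin_le_nhds ?_)
    have : Filter.Tendsto (fun t : ℝ => ‖t • v‖) (𝓝 0) (𝓝 ‖(0 : ℝ) • v‖) :=
      (by fun_prop : Continuous fun t : ℝ => ‖t • v‖).tendsto 0
    rw [zero_smul, norm_zero] at this
    exact (this.eventually (gt_mem_nhds hr)).mono fun t ht => le_of_lt ht
  -- The depths are fixed before any `A` enters, so one function `q = 2 s / t²` serves all
  -- Weingarten maps at `x`.
  have hex : ∀ t : ℝ, ∃ s : ℝ, (0 < t ∧ ‖t • v‖ ≤ r) →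
      0 ≤ s ∧ s ≤ ‖t • v‖ ^ 2 / r ∧ x + t • v - s • N ∈ frontier K := by
    intro t
    by_cases ht : 0 < t ∧ ‖t • v‖ ≤ r
    · obtain ⟨s, hs⟩ := hK.exists_mem_frontier hx hN (v := t • v)
        (by rw [inner_smul_left, hv, mul_zero]) ht.2
      exact ⟨s, fun _ => hs⟩
    · exact ⟨0, fun h => absurd h ht⟩
  choose s hs using hex
  have hbd : ∀ t, (0 < t ∧ ‖t • v‖ ≤ r) → 2 * s t / t ^ 2 ∈ Set.Icc 0 (2 * ‖v‖ ^ 2 / r) := by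
    intro t ht
    obtain ⟨h0, h1, -⟩ := hs t ht
    have htp := ht.1
    refine ⟨by positivity, ?_⟩
    rw [norm_smul, mul_pow, Real.norm_eq_abs, sq_abs] at h1
    rw [div_le_iff₀ (by positivity)]
    calc 2 * s t ≤ 2 * (t ^ 2 * ‖v‖ ^ 2 / r) := by linarith
      _ = _ := by ring
  refine ⟨fun t => 2 * s t / t ^ 2, hsmall.mono hbd, fun A hA => ?_⟩
  obtain ⟨hsym, hAN, hlit⟩ := hA
  let y : ℝ → Eucl n := fun t => x + t • v - s t • N
  have hyx : ∀ t, y t - x = t • v - s t • N := fun t => by simp only [y]; module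
  have hnorm : ∀ᶠ t in 𝓝[>] (0 : ℝ), ‖y t - x‖ ≤ (‖v‖ + ‖v‖ ^ 2 / r * t) * t := by
    filter_upwards [hsmall] with t ht
    obtain ⟨h0, h1, -⟩ := hs t ht
    rw [hyx]
    refine (norm_sub_le _ _).trans ?_
    rw [norm_smul, norm_smul, hN.1, Real.norm_eq_abs, Real.norm_eq_abs, abs_of_pos ht.1,
      abs_of_nonneg h0]
    rw [norm_smul, mul_pow, Real.norm_eq_abs, sq_abs] at h1
    calc t * ‖v‖ + s t * 1 ≤ t * ‖v‖ + t ^ 2 * ‖v‖ ^ 2 / r := by linarith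
      _ = _ := by ring
  have hO : (fun t => ‖y t - x‖ ^ 2) =O[𝓝[>] (0 : ℝ)] fun t => t ^ 2 := by
    have hb : ∀ᶠ t in 𝓝[>] (0 : ℝ), t < 1 := Filter.Eventually.filter_mono nhdsWithin_le_nhds
      (gt_mem_nhds one_pos)
    refine Asymptotics.IsBigO.of_bound ((‖v‖ + ‖v‖ ^ 2 / r) ^ 2) ?_
    filter_upwards [hnorm, hsmall, hb] with t ht ht2 ht3
    rw [Real.norm_eq_abs, Real.norm_eq_abs, abs_of_nonneg (by positivity),
      abs_of_nonneg (by positivity), ← mul_pow]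
    refine pow_le_pow_left₀ (norm_nonneg _) (ht.trans ?_) 2
    have := ht2.1
    have h3 : 0 ≤ ‖v‖ ^ 2 / r := by positivity
    gcongr
    nlinarith
  have hy : Filter.Tendsto y (𝓝[>] 0) (𝓝[frontier K] x) := by
    rw [tendsto_nhdsWithin_iff]
    refine ⟨?_, hsmall.mono fun t ht => (hs t ht).2.2⟩
    rw [tendsto_iff_norm_sub_tendsto_zero]
    refine squeeze_zero' (Filter.Eventually.of_forall fun _ => norm_nonneg _) hnorm ?_
    have : Filter.Tendsto (fun t : ℝ => (‖v‖ + ‖v‖ ^ 2 / r * t) * t) (𝓝 0)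
        (𝓝 ((‖v‖ + ‖v‖ ^ 2 / r * 0) * 0)) :=
      (by fun_prop : Continuous fun t : ℝ => (‖v‖ + ‖v‖ ^ 2 / r * t) * t).tendsto 0
    rw [mul_zero] at this
    exact this.mono_left nhdsWithin_le_nhds
  -- Along the section `‖y t - x‖` is `O(t)`, so the Taylor error is `o(t²)`; as `A N = 0`, only `t
  -- v` enters the quadratic term.
  have hlit2 := (hlit.comp_tendsto hy).trans_isBigO hO
  have key : ∀ t, ⟪x - y t, N⟫ - 1 / 2 * ⟪A (y t - x), y t - x⟫
      = s t - 1 / 2 * t ^ 2 * ⟪A v, v⟫ := by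
    intro t
    have h1 : x - y t = s t • N - t • v := by rw [← neg_sub, hyx]; module
    have h2 : ⟪A v, N⟫ = 0 := by rw [hsym v N, hAN, inner_zero_right]
    rw [hyx, h1, map_sub, map_smul, map_smul, hAN, smul_zero, sub_zero]
    simp only [inner_sub_left, inner_sub_right, inner_smul_left, inner_smul_right, hv, h2, e1,
      RCLike.conj_to_real]
    ring
  have h3 := hlit2.tendsto_div_nhds_zero
  have h4 : Filter.Tendsto
      (fun t => 2 * ((s t - 1 / 2 * t ^ 2 * ⟪A v, v⟫) / t ^ 2) + ⟪A v, v⟫) (𝓝[>] 0)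
      (𝓝 (2 * 0 + ⟪A v, v⟫)) := by
    refine (Filter.Tendsto.const_mul 2 ?_).add_const _
    refine h3.congr fun t => ?_
    simp only [Function.comp, key]
  rw [mul_zero, zero_add] at h4
  refine h4.congr' ?_
  filter_upwards [hsmall] with t ht
  have := ht.1.ne'
  field_simp
  ring

theorem HasInnerBall.quadratic_mem_Icc {K : Set (Eucl n)} {r : ℝ} (hK : HasInnerBall K r)
    {x N v : Eucl n} (hx : x ∈ frontier K) (hN : IsOuterUnitNormal K x N) (hv : ⟪v, N⟫ = 0)
    {A : Eucl n →ₗ[ℝ] Eucl n} (hA : IsWeingartenMap K x N A) :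
    ⟪A v, v⟫ ∈ Set.Icc 0 (2 * ‖v‖ ^ 2 / r) := by
  obtain ⟨q, hq, hlim⟩ := hK.exists_tendsto_quadratic hx hN hv
  exact isClosed_Icc.mem_of_tendsto (hlim A hA) hq

/-- Removing the normal component reduces statements about the form on the whole space to tangent
vectors. -/
theorem exists_tangential_part {N : Eucl n} (hN : ‖N‖ = 1) (v : Eucl n) :
    ∃ w : Eucl n, ⟪w, N⟫ = 0 ∧ ‖w‖ ≤ ‖v‖ ∧ ∀ A : Eucl n →ₗ[ℝ] Eucl n, A.IsSymmetric → A N = 0 →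
      ⟪A v, v⟫ = ⟪A w, w⟫ := by
  have e1 : ⟪N, N⟫ = 1 := by rw [real_inner_self_eq_norm_sq, hN]; norm_num
  refine ⟨v - ⟪v, N⟫ • N, ?_, ?_, fun A hA hAN => ?_⟩
  · rw [inner_sub_left, inner_smul_left, e1]; simp
  · refine (sq_le_sq₀ (norm_nonneg _) (norm_nonneg v)).1 ?_
    rw [norm_sub_sq_real, inner_smul_right, norm_smul, hN, Real.norm_eq_abs, mul_one, sq_abs]
    nlinarith [sq_nonneg ⟪v, N⟫]
  · have h2 : ⟪A v, N⟫ = 0 := by rw [hA v N, hAN, inner_zero_right]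
    rw [map_sub, map_smul, hAN, smul_zero, sub_zero, inner_sub_right, inner_smul_right, h2]
    simp

theorem HasInnerBall.quadratic_mem_Icc' {K : Set (Eucl n)} {r : ℝ} (hK : HasInnerBall K r)
    {x N : Eucl n} (v : Eucl n) (hx : x ∈ frontier K) (hN : IsOuterUnitNormal K x N)
    {A : Eucl n →ₗ[ℝ] Eucl n} (hA : IsWeingartenMap K x N A) :
    ⟪A v, v⟫ ∈ Set.Icc 0 (2 * ‖v‖ ^ 2 / r) := by
  obtain ⟨w, hw, hwv, h⟩ := exists_tangential_part hN.1 v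
  rw [h A hA.1 hA.2.1]
  have hr := hK.pos
  refine Set.Icc_subset_Icc_right ?_ (hK.quadratic_mem_Icc hx hN hw hA)
  gcongr

/-- Both quadratic forms are limits of the same quotients, and a symmetric map is determined by its
quadratic form. -/
theorem HasInnerBall.weingartenMap_unique {K : Set (Eucl n)} {r : ℝ} (hK : HasInnerBall K r)
    {x N : Eucl n} (hx : x ∈ frontier K) (hN : IsOuterUnitNormal K x N)
    {A B : Eucl n →ₗ[ℝ] Eucl n} (hA : IsWeingartenMap K x N A) (hB : IsWeingartenMap K x N B) :
    A = B := by
  have hq : ∀ v, ⟪A v, v⟫ = ⟪B v, v⟫ := by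
    intro v
    obtain ⟨w, hw, -, h⟩ := exists_tangential_part hN.1 v
    rw [h A hA.1 hA.2.1, h B hB.1 hB.2.1]
    obtain ⟨q, -, hlim⟩ := hK.exists_tendsto_quadratic hx hN hw
    exact tendsto_nhds_unique (hlim A hA) (hlim B hB)
  have hsym : (A - B).IsSymmetric := hA.1.sub hB.1
  have h0 := (hsym.inner_map_self_eq_zero).1 fun v => by
    rw [LinearMap.sub_apply, inner_sub_left, hq, sub_self]
  exact sub_eq_zero.1 h0

theorem HasInnerBall.norm_weingartenMap_le {K : Set (Eucl n)} {r : ℝ} (hK : HasInnerBall K r)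
    {x N : Eucl n} (hx : x ∈ frontier K) (hN : IsOuterUnitNormal K x N)
    {A : Eucl n →ₗ[ℝ] Eucl n} (hA : IsWeingartenMap K x N A) (v : Eucl n) :
    ‖A v‖ ≤ 2 / r * ‖v‖ := by
  have hr := hK.pos
  rcases eq_or_ne (A v) 0 with h0 | h0
  · rw [h0, norm_zero]; positivity
  rcases eq_or_ne v 0 with rfl | hv0
  · simp
  have ha : 0 < ‖A v‖ := norm_pos_iff.2 h0
  have hb : 0 < ‖v‖ := norm_pos_iff.2 hv0
  set a := ‖A v‖
  set b := ‖v‖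
  -- Polarization: the weights give `a • v` and `b • A v` the same norm `a b`. The upper bound at
  -- the sum and nonnegativity at the difference then yield exactly `2 / r`.
  have h1 := (hK.quadratic_mem_Icc' (a • v + b • A v) hx hN hA).2
  have h2 := (hK.quadratic_mem_Icc' (a • v - b • A v) hx hN hA).1
  have e1 : ⟪A v, A v⟫ = a ^ 2 := real_inner_self_eq_norm_sq _
  have e2 : ⟪A (A v), v⟫ = a ^ 2 := by rw [hA.1 (A v) v, e1]
  have e3 : ‖a • v + b • A v‖ ≤ 2 * (a * b) := by
    refine (norm_add_le _ _).trans (le_of_eq ?_)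
    rw [norm_smul, norm_smul, Real.norm_eq_abs, Real.norm_eq_abs, abs_of_pos ha, abs_of_pos hb]
    simp only [a, b]; ring
  have e4 : 2 * ‖a • v + b • A v‖ ^ 2 / r ≤ 2 * (2 * (a * b)) ^ 2 / r := by gcongr
  have h3 : ⟪A (a • v + b • A v), a • v + b • A v⟫ - ⟪A (a • v - b • A v), a • v - b • A v⟫
      = 4 * (a * b) * a ^ 2 := by
    simp only [map_add, map_sub, map_smul, inner_add_left, inner_add_right, inner_sub_left,
      inner_sub_right, inner_smul_left, inner_smul_right, e1, e2, RCLike.conj_to_real]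
    ring
  have h4 : 4 * (a * b) * a ^ 2 ≤ 2 * (2 * (a * b)) ^ 2 / r := by linarith
  have h5 : 2 * (2 * (a * b)) ^ 2 / r = 4 * (a * b) * a * (2 / r * b) := by ring
  rw [h5] at h4
  have h6 : 0 < 4 * (a * b) * a := by positivity
  refine le_of_mul_le_mul_left ?_ h6
  linarith

/-! ### Curvature functions as coefficients of the characteristic polynomial -/

theorem esymm_zero_cons (s : Multiset ℝ) (j : ℕ) :
    (Multiset.cons 0 s).esymm j = s.esymm j := by
  cases j with
  | zero => simp [Multiset.esymm]
  | succ j => simp [Multiset.esymm, Multiset.powersetCard_cons, Multiset.map_map]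

theorem esymm_erase_zero (s : Multiset ℝ) (j : ℕ) : (s.erase 0).esymm j = s.esymm j := by
  by_cases h : (0 : ℝ) ∈ s
  · conv_rhs => rw [← Multiset.cons_erase h]
    rw [esymm_zero_cons]
  · rw [Multiset.erase_of_notMem h]

/-- The elementary symmetric function of the eigenvalues, read off the characteristic polynomial. -/
theorem esymm_roots_charpoly {A : Eucl n →ₗ[ℝ] Eucl n} (hA : A.IsSymmetric) {j : ℕ} (hj : j ≤ n) :
    (A.charpoly.roots.erase 0).esymm j = (-1) ^ j * A.charpoly.coeff (n - j) := by
  have hdeg : A.charpoly.natDegree = n := by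
    rw [LinearMap.charpoly_natDegree, finrank_euclideanSpace, Fintype.card_fin]
  have hsplit : A.charpoly.Splits := hA.splits_charpoly
  rw [esymm_erase_zero, Polynomial.coeff_eq_esymm_roots_of_splits hsplit (by omega),
    A.charpoly_monic.leadingCoeff, hdeg, Nat.sub_sub_self hj, one_mul, ← mul_assoc, ← mul_pow]
  simp

theorem isSymmetric_weingarten (K : Set (Eucl n)) (x : Eucl n) :
    (weingarten K x).IsSymmetric := by
  rw [weingarten]
  split_ifs with h
  · exact h.choose_spec.1
  · exact LinearMap.IsSymmetric.zero

theorem symCurv_eq_coeff (K : Set (Eucl n)) (x : Eucl n) {j : ℕ} (hj : j ≤ n) :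
    symCurv K j x =
      ((n - 1).choose j : ℝ)⁻¹ * ((-1) ^ j * (weingarten K x).charpoly.coeff (n - j)) := by
  rw [symCurv, principalCurvatures, esymm_roots_charpoly (isSymmetric_weingarten K x) hj]

/-- A universal polynomial in the matrix entries: its homogeneity gives the scaling of `H_j`, its
continuity the boundedness. -/
theorem charpoly_coeff_eq_eval (A : Eucl n →ₗ[ℝ] Eucl n) (i : ℕ) :
    A.charpoly.coeff i = MvPolynomial.eval
      (fun p : Fin n × Fin n => A (EuclideanSpace.basisFun (Fin n) ℝ p.2) p.1)
      ((Matrix.charpoly.univ ℝ (Fin n)).coeff i) := by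
  rw [← LinearMap.charpoly_toMatrix A (EuclideanSpace.basisFun (Fin n) ℝ).toBasis]
  have h := Matrix.charpoly.univ_coeff_eval₂Hom (Fin n) (RingHom.id ℝ)
    (fun p : Fin n × Fin n => A (EuclideanSpace.basisFun (Fin n) ℝ p.2) p.1) i
  rw [MvPolynomial.eval]
  rw [h]
  congr 2
  ext a b
  simp [LinearMap.toMatrix_apply]

theorem _root_.MvPolynomial.IsHomogeneous.eval_smul_eq {σ : Type*} {p : MvPolynomial σ ℝ} {m : ℕ}
    (hp : p.IsHomogeneous m) (c : ℝ) (f : σ → ℝ) :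
    MvPolynomial.eval (c • f) p = c ^ m * MvPolynomial.eval f p := by
  rw [MvPolynomial.eval_eq, MvPolynomial.eval_eq, Finset.mul_sum]
  refine Finset.sum_congr rfl fun d hd => ?_
  have hm : ∑ i ∈ d.support, d i = m := by
    simpa [Finsupp.weight_apply, Finsupp.sum] using hp (MvPolynomial.mem_support_iff.1 hd)
  simp only [Pi.smul_apply, smul_eq_mul, mul_pow, Finset.prod_mul_distrib,
    Finset.prod_pow_eq_pow_sum]
  rw [hm]
  ring

theorem charpoly_smul_coeff (A : Eucl n →ₗ[ℝ] Eucl n) (c : ℝ) {j : ℕ} (hj : j ≤ n) :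
    (c • A).charpoly.coeff (n - j) = c ^ j * A.charpoly.coeff (n - j) := by
  rw [charpoly_coeff_eq_eval, charpoly_coeff_eq_eval]
  exact (Matrix.charpoly.univ_coeff_isHomogeneous ℝ (Fin n) (n - j) j
    (by rw [Fintype.card_fin]; omega)).eval_smul_eq c _

theorem continuous_charpoly_coeff (i : ℕ) :
    Continuous fun A : Eucl n →L[ℝ] Eucl n => (A : Eucl n →ₗ[ℝ] Eucl n).charpoly.coeff i := by
  simp only [charpoly_coeff_eq_eval]
  refine (MvPolynomial.continuous_eval _).comp ?_
  refine continuous_pi fun p => ?_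
  have : Continuous fun A : Eucl n →L[ℝ] Eucl n => A (EuclideanSpace.basisFun (Fin n) ℝ p.2) := by
    fun_prop
  exact (EuclideanSpace.proj p.1 : Eucl n →L[ℝ] ℝ).continuous.comp this

/-! ### Behaviour under similarities -/

/-- The similarity `x ↦ t L x + b` with `t > 0` and a linear isometry `L`. -/
structure Similarity (n : ℕ) where
  t : ℝ
  pos : 0 < t
  L : Eucl n ≃ₗᵢ[ℝ] Eucl n
  b : Eucl n

namespace Similarity

def toHomeomorph (φ : Similarity n) : Eucl n ≃ₜ Eucl n :=
  (φ.L.toHomeomorph.trans (Homeomorph.smulOfNeZero φ.t φ.pos.ne')).trans (Homeomorph.addRight φ.b)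

theorem toHomeomorph_apply (φ : Similarity n) (x : Eucl n) :
    φ.toHomeomorph x = φ.t • φ.L x + φ.b := rfl

def symm (φ : Similarity n) : Similarity n where
  t := φ.t⁻¹
  pos := inv_pos.2 φ.pos
  L := φ.L.symm
  b := -(φ.t⁻¹ • φ.L.symm φ.b)

theorem symm_apply_apply (φ : Similarity n) (x : Eucl n) :
    φ.symm.toHomeomorph (φ.toHomeomorph x) = x := by
  have := φ.pos.ne'
  simp only [toHomeomorph_apply, symm, map_add, map_smul, LinearIsometryEquiv.symm_apply_apply,
    smul_add, smul_smul, inv_mul_cancel₀ this, one_smul, add_neg_cancel_right]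

theorem symm_image_image (φ : Similarity n) (K : Set (Eucl n)) :
    φ.symm.toHomeomorph '' (φ.toHomeomorph '' K) = K := by
  simp only [Set.image_image, symm_apply_apply, Set.image_id']

theorem sub_apply (φ : Similarity n) (x y : Eucl n) :
    φ.toHomeomorph x - φ.toHomeomorph y = φ.t • φ.L (x - y) := by
  simp only [toHomeomorph_apply, map_sub]
  module

theorem isOuterUnitNormal_image (φ : Similarity n) {K : Set (Eucl n)} {x N : Eucl n}
    (h : IsOuterUnitNormal K x N) :
    IsOuterUnitNormal (φ.toHomeomorph '' K) (φ.toHomeomorph x) (φ.L N) := by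
  refine ⟨by rw [φ.L.norm_map, h.1], ?_⟩
  rintro _ ⟨y, hy, rfl⟩
  rw [sub_apply, inner_smul_left, φ.L.inner_map_map]
  exact mul_nonpos_of_nonneg_of_nonpos φ.pos.le (h.2 y hy)

theorem isOuterUnitNormal_of_image (φ : Similarity n) {K : Set (Eucl n)} {x N : Eucl n}
    (h : IsOuterUnitNormal (φ.toHomeomorph '' K) (φ.toHomeomorph x) N) :
    IsOuterUnitNormal K x (φ.L.symm N) := by
  have := φ.symm.isOuterUnitNormal_image h
  rwa [symm_image_image, symm_apply_apply] at this

/-- The Weingarten map of the image under a similarity. -/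
def conjMap (φ : Similarity n) (A : Eucl n →ₗ[ℝ] Eucl n) : Eucl n →ₗ[ℝ] Eucl n :=
  φ.t⁻¹ • (φ.L.toLinearEquiv.conj A)

theorem conjMap_apply (φ : Similarity n) (A : Eucl n →ₗ[ℝ] Eucl n) (v : Eucl n) :
    φ.conjMap A v = φ.t⁻¹ • φ.L (A (φ.L.symm v)) := rfl

theorem charpoly_conjMap_coeff (φ : Similarity n) (A : Eucl n →ₗ[ℝ] Eucl n) {j : ℕ}
    (hj : j ≤ n) :
    (φ.conjMap A).charpoly.coeff (n - j) = φ.t⁻¹ ^ j * A.charpoly.coeff (n - j) := by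
  rw [conjMap, charpoly_smul_coeff _ _ hj, LinearEquiv.charpoly_conj]

/-- Height and quadratic term both scale by `t`, the squared distance by `t²`; constant factors do
not affect the little-o. -/
theorem isWeingartenMap_image (φ : Similarity n) {K : Set (Eucl n)} {x N : Eucl n}
    {A : Eucl n →ₗ[ℝ] Eucl n} (h : IsWeingartenMap K x N A) :
    IsWeingartenMap (φ.toHomeomorph '' K) (φ.toHomeomorph x) (φ.L N) (φ.conjMap A) := by
  obtain ⟨hsym, hN, ho⟩ := h
  have hadj : ∀ u v, ⟪φ.L u, v⟫ = ⟪u, φ.L.symm v⟫ := fun u v => by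
    rw [← φ.L.inner_map_map u, φ.L.apply_symm_apply]
  have ht := φ.pos.ne'
  refine ⟨fun u v => ?_, ?_, ?_⟩
  · rw [conjMap_apply, conjMap_apply, inner_smul_left, inner_smul_right, hadj, hsym,
      real_inner_comm (φ.L _) u, hadj, real_inner_comm (φ.L.symm u)]
    rfl
  · rw [conjMap_apply, φ.L.symm_apply_apply, hN, map_zero, smul_zero]
  · rw [← φ.toHomeomorph.image_frontier, ← φ.toHomeomorph.isEmbedding.map_nhdsWithin_eq,
      Asymptotics.isLittleO_map]
    have e1 : (fun y => ⟪φ.toHomeomorph x - y, φ.L N⟫ - 1 / 2 *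
        ⟪φ.conjMap A (y - φ.toHomeomorph x), y - φ.toHomeomorph x⟫) ∘ φ.toHomeomorph =
        fun y => φ.t * (⟪x - y, N⟫ - 1 / 2 * ⟪A (y - x), y - x⟫) := by
      funext y
      simp only [Function.comp, sub_apply, conjMap_apply, map_smul, φ.L.symm_apply_apply,
        inner_smul_left, inner_smul_right, φ.L.inner_map_map, RCLike.conj_to_real]
      field_simp
    have e2 : (fun y => ‖y - φ.toHomeomorph x‖ ^ 2) ∘ φ.toHomeomorph =
        fun y => φ.t ^ 2 * ‖y - x‖ ^ 2 := by
      funext y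
      simp only [Function.comp, sub_apply, norm_smul, φ.L.norm_map, Real.norm_eq_abs, mul_pow,
        sq_abs]
    rw [e1, e2]
    exact (Asymptotics.isLittleO_const_mul_right_iff (pow_ne_zero 2 ht)).2 (ho.const_mul_left _)

theorem hasInnerBall_image (φ : Similarity n) {K : Set (Eucl n)} {r : ℝ}
    (hK : HasInnerBall K r) : HasInnerBall (φ.toHomeomorph '' K) (φ.t * r) where
  body := by
    refine ⟨hK.body.1.image φ.toHomeomorph.continuous, ?_, ?_⟩
    · have : φ.toHomeomorph '' K = (fun y => φ.b + y) '' (φ.t • (φ.L '' K)) := by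
        rw [← Set.image_smul, Set.image_image, Set.image_image]
        exact Set.image_congr fun x _ => (φ.toHomeomorph_apply x).trans (add_comm _ _)
      rw [this]
      have h1 : Convex ℝ (φ.L '' K) := hK.body.2.1.linear_image φ.L.toLinearEquiv.toLinearMap
      exact (h1.smul _).translate _
    · rw [← φ.toHomeomorph.image_interior]
      exact hK.body.2.2.image _
  pos := mul_pos φ.pos hK.pos
  ball := by
    rw [← φ.toHomeomorph.image_frontier]
    rintro _ ⟨x, hx, rfl⟩ N hN z hz
    have h := hK.ball x hx _ (φ.isOuterUnitNormal_of_image hN)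
    obtain ⟨y, rfl⟩ := φ.toHomeomorph.surjective z
    refine ⟨y, h ?_, rfl⟩
    rw [Metric.mem_closedBall, dist_eq_norm] at hz ⊢
    have e : φ.toHomeomorph y - (φ.toHomeomorph x - (φ.t * r) • N) =
        φ.t • φ.L (y - (x - r • φ.L.symm N)) := by
      rw [← sub_add, sub_apply]
      simp only [map_sub, map_smul, φ.L.apply_symm_apply]
      module
    rw [e, norm_smul, φ.L.norm_map, Real.norm_eq_abs, abs_of_pos φ.pos] at hz
    exact le_of_mul_le_mul_left hz φ.pos

theorem outerNormal_image (φ : Similarity n) {K : Set (Eucl n)} {r : ℝ}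
    (hK : HasInnerBall K r) {x : Eucl n} (hx : x ∈ frontier K) :
    outerNormal (φ.toHomeomorph '' K) (φ.toHomeomorph x) = φ.L (outerNormal K x) := by
  have hK' := φ.hasInnerBall_image hK
  have hx' : φ.toHomeomorph x ∈ frontier (φ.toHomeomorph '' K) := by
    rw [← φ.toHomeomorph.image_frontier]
    exact ⟨x, hx, rfl⟩
  exact hK'.normal_unique hx' (hK'.body.outerNormal_spec hx')
    (φ.isOuterUnitNormal_image (hK.body.outerNormal_spec hx))

end Similarity

theorem HasInnerBall.weingarten_eq {K : Set (Eucl n)} {r : ℝ} (hK : HasInnerBall K r)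
    {x : Eucl n} (hx : x ∈ frontier K) {A : Eucl n →ₗ[ℝ] Eucl n}
    (hA : IsWeingartenMap K x (outerNormal K x) A) : weingarten K x = A := by
  have h : ∃ A, IsWeingartenMap K x (outerNormal K x) A := ⟨A, hA⟩
  rw [weingarten, dif_pos h]
  exact hK.weingartenMap_unique hx (hK.body.outerNormal_spec hx) h.choose_spec hA

namespace Similarity

/-- Uniqueness settles the points where a Weingarten map exists. Elsewhere the inverse similarity
shows that the image has none either, and both sides take the default `0`; so the rule holds at
every boundary point. -/
theorem weingarten_image (φ : Similarity n) {K : Set (Eucl n)} {r : ℝ}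
    (hK : HasInnerBall K r) {x : Eucl n} (hx : x ∈ frontier K) :
    weingarten (φ.toHomeomorph '' K) (φ.toHomeomorph x) = φ.conjMap (weingarten K x) := by
  have hK' := φ.hasInnerBall_image hK
  have hx' : φ.toHomeomorph x ∈ frontier (φ.toHomeomorph '' K) := by
    rw [← φ.toHomeomorph.image_frontier]
    exact ⟨x, hx, rfl⟩
  by_cases h : ∃ A, IsWeingartenMap K x (outerNormal K x) A
  · obtain ⟨A, hA⟩ := h
    rw [hK.weingarten_eq hx hA]
    apply hK'.weingarten_eq hx'
    rw [φ.outerNormal_image hK hx]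
    exact φ.isWeingartenMap_image hA
  · have h' : ¬ ∃ A, IsWeingartenMap (φ.toHomeomorph '' K) (φ.toHomeomorph x)
        (outerNormal (φ.toHomeomorph '' K) (φ.toHomeomorph x)) A := by
      rintro ⟨A, hA⟩
      refine h ⟨φ.symm.conjMap A, ?_⟩
      have := φ.symm.isWeingartenMap_image hA
      rw [symm_image_image, symm_apply_apply, φ.outerNormal_image hK hx] at this
      have e : φ.symm.L (φ.L (outerNormal K x)) = outerNormal K x := φ.L.symm_apply_apply _
      rwa [e] at this
    rw [weingarten, weingarten, dif_neg h, dif_neg h', conjMap, map_zero, smul_zero]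

theorem symCurv_image (φ : Similarity n) {K : Set (Eucl n)} {r : ℝ}
    (hK : HasInnerBall K r) {x : Eucl n} (hx : x ∈ frontier K) {j : ℕ} (hj : j ≤ n) :
    symCurv (φ.toHomeomorph '' K) j (φ.toHomeomorph x) = φ.t⁻¹ ^ j * symCurv K j x := by
  rw [symCurv_eq_coeff _ _ hj, symCurv_eq_coeff _ _ hj, φ.weingarten_image hK hx,
    φ.charpoly_conjMap_coeff _ hj]
  ring

end Similarity

/-- For negative `b` the real power carries a cosine factor depending on `c` only, so a positive
factor still splits off and no sign of `H_{n-1}` is needed. -/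
theorem pos_mul_rpow {a : ℝ} (ha : 0 < a) (b c : ℝ) : (a * b) ^ c = a ^ c * b ^ c := by
  rcases lt_or_ge b 0 with hb | hb
  · rw [Real.rpow_def_of_neg (mul_neg_of_pos_of_neg ha hb), Real.rpow_def_of_neg hb,
      Real.rpow_def_of_pos ha, Real.log_mul ha.ne' hb.ne, add_mul, Real.exp_add, mul_assoc]
  · exact Real.mul_rpow ha.le hb

theorem sum_mul_eq_of_mem_indices {m : ℕ} {i : Fin (n - 1) → ℕ} (hi : i ∈ indices n m) :
    ∑ j : Fin (n - 1), ((j : ℕ) + 1) * i j = m := (Finset.mem_filter.1 hi).2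

namespace Similarity

theorem steinerIntegrand_image (φ : Similarity n) {K : Set (Eucl n)} {r : ℝ}
    (hK : HasInnerBall K r) (k : ℕ) {x : Eucl n} (hx : x ∈ frontier K) :
    steinerIntegrand 1 k k (φ.toHomeomorph '' K) (φ.toHomeomorph x) =
      (φ.t⁻¹ ^ (n - 1)) ^ ((1 : ℝ) / (n + 1)) * φ.t⁻¹ ^ k * steinerIntegrand 1 k k K x := by
  have hsum : ∑ i ∈ indices n k, coeff n 1 i *
      ∏ j : Fin (n - 1), ((n - 1).choose ((j : ℕ) + 1) : ℝ) ^ i j *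
        symCurv (φ.toHomeomorph '' K) ((j : ℕ) + 1) (φ.toHomeomorph x) ^ i j =
      φ.t⁻¹ ^ k * ∑ i ∈ indices n k, coeff n 1 i *
      ∏ j : Fin (n - 1), ((n - 1).choose ((j : ℕ) + 1) : ℝ) ^ i j *
        symCurv K ((j : ℕ) + 1) x ^ i j := by
    rw [Finset.mul_sum]
    refine Finset.sum_congr rfl fun i hi => ?_
    have hprod : ∏ j : Fin (n - 1), ((n - 1).choose ((j : ℕ) + 1) : ℝ) ^ i j *
        symCurv (φ.toHomeomorph '' K) ((j : ℕ) + 1) (φ.toHomeomorph x) ^ i j =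
        (∏ j : Fin (n - 1), φ.t⁻¹ ^ (((j : ℕ) + 1) * i j)) *
        ∏ j : Fin (n - 1), ((n - 1).choose ((j : ℕ) + 1) : ℝ) ^ i j *
          symCurv K ((j : ℕ) + 1) x ^ i j := by
      rw [← Finset.prod_mul_distrib]
      refine Finset.prod_congr rfl fun j _ => ?_
      rw [φ.symCurv_image hK hx (by omega), mul_pow, ← pow_mul]
      ring
    rw [hprod, Finset.prod_pow_eq_pow_sum, sum_mul_eq_of_mem_indices hi]
    ring
  rw [steinerIntegrand, steinerIntegrand, hsum, φ.symCurv_image hK hx (by omega),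
    pos_mul_rpow (pow_pos (inv_pos.2 φ.pos) _)]
  -- The support function occurs to the power `0`, which is `1` even where it vanishes.
  simp only [sub_self, mul_zero, zero_div, add_zero, Real.rpow_zero, one_mul]
  ring

theorem euclideanHausdorffMeasure_image (φ : Similarity n) (d : ℕ) (s : Set (Eucl n)) :
    (μHE[d] : MeasureTheory.Measure (Eucl n)) (φ.toHomeomorph '' s) =
      ENNReal.ofReal (φ.t ^ d) * (μHE[d] : MeasureTheory.Measure (Eucl n)) s := by
  have : φ.toHomeomorph '' s = (IsometryEquiv.addRight φ.b) '' (φ.t • (φ.L '' s)) := by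
    rw [← Set.image_smul, Set.image_image, Set.image_image]
    rfl
  rw [this, (IsometryEquiv.addRight φ.b).isometry.euclideanHausdorffMeasure_image,
    MeasureTheory.Measure.euclideanHausdorffMeasure_smul₀ d φ.pos.ne',
    φ.L.isometry.euclideanHausdorffMeasure_image, ENNReal.smul_def, smul_eq_mul]
  congr 1
  rw [ENNReal.ofReal, Real.toNNReal_pow φ.pos.le]
  congr 2
  ext
  rw [coe_nnnorm, Real.norm_eq_abs, abs_of_pos φ.pos, Real.coe_toNNReal _ φ.pos.le]

theorem boundaryMeasure_image (φ : Similarity n) (K : Set (Eucl n)) :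
    boundaryMeasure (φ.toHomeomorph '' K) =
      ENNReal.ofReal (φ.t ^ (n - 1)) •
        (boundaryMeasure K).map φ.toHomeomorph.toMeasurableEquiv := by
  ext s hs
  rw [MeasureTheory.Measure.smul_apply, MeasurableEquiv.map_apply, boundaryMeasure,
    boundaryMeasure, MeasureTheory.Measure.restrict_apply hs,
    MeasureTheory.Measure.restrict_apply (φ.toHomeomorph.toMeasurableEquiv.measurable hs),
    smul_eq_mul, ← euclideanHausdorffMeasure_image, Set.image_inter φ.toHomeomorph.injective,
    φ.toHomeomorph.image_frontier, Homeomorph.toMeasurableEquiv_coe,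
    Set.image_preimage_eq _ φ.toHomeomorph.surjective]

theorem ae_steinerIntegrand_image (φ : Similarity n) {K : Set (Eucl n)} {r : ℝ}
    (hK : HasInnerBall K r) (k : ℕ) :
    (fun x => steinerIntegrand 1 k k (φ.toHomeomorph '' K) (φ.toHomeomorph x))
      =ᵐ[boundaryMeasure K]
      fun x => ((φ.t⁻¹ ^ (n - 1)) ^ ((1 : ℝ) / (n + 1)) * φ.t⁻¹ ^ k) *
        steinerIntegrand 1 k k K x := by
  rw [boundaryMeasure]
  filter_upwards [MeasureTheory.ae_restrict_mem isClosed_frontier.measurableSet] with x hx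
  exact φ.steinerIntegrand_image hK k hx

theorem integrable_image (φ : Similarity n) {K : Set (Eucl n)} {r : ℝ}
    (hK : HasInnerBall K r) (k : ℕ)
    (h : MeasureTheory.Integrable (steinerIntegrand 1 k k K) (boundaryMeasure K)) :
    MeasureTheory.Integrable (steinerIntegrand 1 k k (φ.toHomeomorph '' K))
      (boundaryMeasure (φ.toHomeomorph '' K)) := by
  rw [boundaryMeasure_image]
  refine MeasureTheory.Integrable.smul_measure ?_ ENNReal.ofReal_ne_top
  rw [MeasureTheory.integrable_map_equiv]
  exact (h.const_mul _).congr (φ.ae_steinerIntegrand_image hK k).symm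

theorem steinerCoeff_image (φ : Similarity n) {K : Set (Eucl n)} {r : ℝ}
    (hK : HasInnerBall K r) (k : ℕ) :
    steinerCoeff 1 k k (φ.toHomeomorph '' K) =
      φ.t ^ (n - 1) * ((φ.t⁻¹ ^ (n - 1)) ^ ((1 : ℝ) / (n + 1)) * φ.t⁻¹ ^ k) *
        steinerCoeff 1 k k K := by
  have ht := φ.pos
  rw [steinerCoeff, boundaryMeasure_image, MeasureTheory.integral_smul_measure,
    MeasureTheory.integral_map_equiv, Homeomorph.toMeasurableEquiv_coe,
    MeasureTheory.integral_congr_ae (φ.ae_steinerIntegrand_image hK k),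
    MeasureTheory.integral_const_mul, ENNReal.toReal_ofReal (by positivity), smul_eq_mul,
    steinerCoeff]
  ring

end Similarity

/-! ### Measurability of the Weingarten map -/

/-- The Weingarten map as a continuous linear map. -/
def weingartenCLM (K : Set (Eucl n)) (x : Eucl n) : Eucl n →L[ℝ] Eucl n :=
  LinearMap.toContinuousLinearMap (weingarten K x)

theorem coe_weingartenCLM (K : Set (Eucl n)) (x : Eucl n) :
    (weingartenCLM K x : Eucl n →ₗ[ℝ] Eucl n) = weingarten K x := rfl

/-- Triples of a boundary point, a normal and a symmetric map that describes the boundary up to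
an error `ε ‖y - x‖ ^ 2` at distance less than `δ`. -/
def approxWeingarten (K : Set (Eucl n)) (ε δ : ℝ) :
    Set (Eucl n × Eucl n × (Eucl n →L[ℝ] Eucl n)) :=
  {p | p.1 ∈ frontier K ∧ (‖p.2.1‖ = 1 ∧ ∀ y ∈ K, ⟪y - p.1, p.2.1⟫ ≤ 0) ∧
    (∀ u v, ⟪p.2.2 u, v⟫ = ⟪u, p.2.2 v⟫) ∧ p.2.2 p.2.1 = 0 ∧
    ∀ y ∈ frontier K, δ ≤ ‖y - p.1‖ ∨
      |⟪p.1 - y, p.2.1⟫ - (1 / 2) * ⟪p.2.2 (y - p.1), y - p.1⟫| ≤ ε * ‖y - p.1‖ ^ 2}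

/-- For each fixed `y` the condition is a union of two non-strict inequalities, continuous in the
triple. -/
theorem isClosed_approxWeingarten (K : Set (Eucl n)) (ε δ : ℝ) :
    IsClosed (approxWeingarten K ε δ) := by
  have h1 : IsClosed {p : Eucl n × Eucl n × (Eucl n →L[ℝ] Eucl n) | ‖p.2.1‖ = 1} :=
    isClosed_eq (by fun_prop) continuous_const
  have h2 : IsClosed {p : Eucl n × Eucl n × (Eucl n →L[ℝ] Eucl n) |
      ∀ y ∈ K, ⟪y - p.1, p.2.1⟫ ≤ 0} := by
    simp only [Set.ofPred_forall]
    exact isClosed_iInter fun y => isClosed_iInter fun _ =>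
      isClosed_le (by fun_prop) continuous_const
  have h3 : IsClosed {p : Eucl n × Eucl n × (Eucl n →L[ℝ] Eucl n) |
      ∀ u v, ⟪p.2.2 u, v⟫ = ⟪u, p.2.2 v⟫} := by
    simp only [Set.ofPred_forall]
    exact isClosed_iInter fun u => isClosed_iInter fun v =>
      isClosed_eq (by fun_prop) (by fun_prop)
  have h4 : IsClosed {p : Eucl n × Eucl n × (Eucl n →L[ℝ] Eucl n) | p.2.2 p.2.1 = 0} :=
    isClosed_eq (by fun_prop) continuous_const
  have h5 : IsClosed {p : Eucl n × Eucl n × (Eucl n →L[ℝ] Eucl n) |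
      ∀ y ∈ frontier K, δ ≤ ‖y - p.1‖ ∨
        |⟪p.1 - y, p.2.1⟫ - (1 / 2) * ⟪p.2.2 (y - p.1), y - p.1⟫| ≤ ε * ‖y - p.1‖ ^ 2} := by
    simp only [Set.ofPred_forall, Set.ofPred_or]
    refine isClosed_iInter fun y => isClosed_iInter fun _ => IsClosed.union ?_ ?_
    · exact isClosed_le continuous_const (by fun_prop)
    · exact isClosed_le (by fun_prop) (by fun_prop)
  exact (isClosed_frontier.preimage continuous_fst).inter
    ((h1.inter h2).inter (h3.inter (h4.inter h5)))

/-- The graph of the Weingarten map, together with the normal. -/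
def weingartenGraph (K : Set (Eucl n)) : Set (Eucl n × Eucl n × (Eucl n →L[ℝ] Eucl n)) :=
  {p | p.1 ∈ frontier K ∧ IsOuterUnitNormal K p.1 p.2.1 ∧
    IsWeingartenMap K p.1 p.2.1 (p.2.2 : Eucl n →ₗ[ℝ] Eucl n)}

/-- The little-o with `ε` and `δ` restricted to reciprocals of positive integers, which makes the
graph Borel. -/
theorem weingartenGraph_eq (K : Set (Eucl n)) :
    weingartenGraph K =
      ⋂ m : ℕ, ⋃ l : ℕ, approxWeingarten K (1 / ((m : ℝ) + 1)) (1 / ((l : ℝ) + 1)) := by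
  ext ⟨x, N, A⟩
  simp only [Set.mem_iInter, Set.mem_iUnion]
  constructor
  · rintro ⟨hx, hN, hsym, hAN, ho⟩ m
    have h := ho.def (c := 1 / ((m : ℝ) + 1)) (by positivity)
    rw [Filter.Eventually, Metric.mem_nhdsWithin_iff] at h
    obtain ⟨δ, hδ, hb⟩ := h
    obtain ⟨l, hl⟩ := exists_nat_one_div_lt hδ
    refine ⟨l, hx, hN, hsym, hAN, fun y hy => ?_⟩
    by_contra! hc
    have := hb ⟨by rw [Metric.mem_ball, dist_eq_norm]; exact hc.1.trans hl, hy⟩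
    simp only [Set.mem_ofPred_eq, Real.norm_eq_abs, abs_pow, abs_norm] at this
    exact absurd this (not_le.2 hc.2)
  · intro h
    obtain ⟨l, hx, hN, hsym, hAN, -⟩ := h 0
    refine ⟨hx, hN, hsym, hAN, ?_⟩
    rw [Asymptotics.isLittleO_iff]
    intro c hc
    obtain ⟨m, hm⟩ := exists_nat_one_div_lt hc
    obtain ⟨l, -, -, -, -, hl⟩ := h m
    rw [Filter.Eventually, Metric.mem_nhdsWithin_iff]
    refine ⟨1 / ((l : ℝ) + 1), by positivity, fun y hy => ?_⟩
    have hd := hy.1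
    rw [Metric.mem_ball, dist_eq_norm] at hd
    have := (hl y hy.2).resolve_left (not_le.2 hd)
    simp only [Set.mem_ofPred_eq, Real.norm_eq_abs, abs_pow, abs_norm]
    refine this.trans ?_
    gcongr

theorem measurableSet_weingartenGraph (K : Set (Eucl n)) :
    MeasurableSet (weingartenGraph K) := by
  rw [weingartenGraph_eq]
  exact MeasurableSet.iInter fun m => MeasurableSet.iUnion fun l =>
    (isClosed_approxWeingarten K _ _).measurableSet

theorem HasInnerBall.injOn_weingartenGraph {K : Set (Eucl n)} {r : ℝ} (hK : HasInnerBall K r) :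
    Set.InjOn Prod.fst (weingartenGraph K) := by
  rintro ⟨x, N, A⟩ ⟨hx, hN, hA⟩ ⟨x', N', A'⟩ ⟨hx', hN', hA'⟩ (rfl : x = x')
  obtain rfl : N = N' := hK.normal_unique hx hN hN'
  have : (A : Eucl n →ₗ[ℝ] Eucl n) = A' := hK.weingartenMap_unique hx hN hA hA'
  rw [ContinuousLinearMap.coe_injective this]

/-- Lusin–Souslin: the projection to the base point is injective on the Borel graph, so it maps
Borel pieces to Borel sets. -/
theorem HasInnerBall.measurable_weingartenCLM {K : Set (Eucl n)} {r : ℝ}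
    (hK : HasInnerBall K r) :
    Measurable ((frontier K).indicator (weingartenCLM K)) := by
  intro s hs
  have himage : ∀ t : Set (Eucl n →L[ℝ] Eucl n), MeasurableSet t →
      MeasurableSet (Prod.fst '' (weingartenGraph K ∩ {p | p.2.2 ∈ t})) := fun t ht =>
    ((measurableSet_weingartenGraph K).inter
      ((measurable_snd.comp measurable_snd) ht)).image_of_measurable_injOn measurable_fst
      (hK.injOn_weingartenGraph.mono Set.inter_subset_left)
  have hmem : ∀ (t : Set (Eucl n →L[ℝ] Eucl n)) x,
      x ∈ Prod.fst '' (weingartenGraph K ∩ {p | p.2.2 ∈ t}) ↔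
      x ∈ frontier K ∧ (∃ A, IsWeingartenMap K x (outerNormal K x) A) ∧
        weingartenCLM K x ∈ t := by
    intro t x
    constructor
    · rintro ⟨⟨y, N, A⟩, ⟨⟨hx, hN, hA⟩, ht⟩, rfl⟩
      obtain rfl : N = outerNormal K y := hK.normal_unique hx hN (hK.body.outerNormal_spec hx)
      refine ⟨hx, ⟨_, hA⟩, ?_⟩
      have : weingartenCLM K y = A := by
        apply ContinuousLinearMap.coe_injective
        rw [coe_weingartenCLM, hK.weingarten_eq hx hA]
      rw [this]
      exact ht
    · rintro ⟨hx, ⟨A, hA⟩, ht⟩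
      refine ⟨(x, outerNormal K x, weingartenCLM K x),
        ⟨⟨hx, hK.body.outerNormal_spec hx, ?_⟩, ht⟩, rfl⟩
      change IsWeingartenMap K x (outerNormal K x) (weingartenCLM K x : Eucl n →ₗ[ℝ] Eucl n)
      rwa [coe_weingartenCLM, hK.weingarten_eq hx hA]
  -- The second piece collects the points with value `0` by default: those off the frontier and
  -- those without a Weingarten map.
  have hpre : (frontier K).indicator (weingartenCLM K) ⁻¹' s =
      Prod.fst '' (weingartenGraph K ∩ {p | p.2.2 ∈ s}) ∪
      ((Prod.fst '' (weingartenGraph K ∩ {p | p.2.2 ∈ Set.univ}))ᶜ ∩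
        {_x | (0 : Eucl n →L[ℝ] Eucl n) ∈ s}) := by
    ext x
    rw [Set.mem_union, Set.mem_inter_iff, Set.mem_compl_iff, hmem, hmem, Set.mem_preimage,
      Set.mem_ofPred_eq]
    by_cases hx : x ∈ frontier K
    · rw [Set.indicator_of_mem hx]
      by_cases hA : ∃ A, IsWeingartenMap K x (outerNormal K x) A
      · simp [hx, hA]
      · have h0 : weingartenCLM K x = 0 := by
          rw [weingartenCLM, weingarten, dif_neg hA, map_zero]
        simp [hx, hA, h0]
    · rw [Set.indicator_of_notMem hx]
      simp [hx]
  rw [hpre]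
  exact (himage s hs).union ((himage _ MeasurableSet.univ).compl.inter (MeasurableSet.const _))

theorem HasInnerBall.aemeasurable_weingartenCLM {K : Set (Eucl n)} {r : ℝ}
    (hK : HasInnerBall K r) : AEMeasurable (weingartenCLM K) (boundaryMeasure K) := by
  refine ⟨_, hK.measurable_weingartenCLM, ?_⟩
  rw [boundaryMeasure]
  filter_upwards [MeasureTheory.ae_restrict_mem isClosed_frontier.measurableSet] with x hx
  rw [Set.indicator_of_mem hx]

theorem HasInnerBall.norm_weingartenCLM_le {K : Set (Eucl n)} {r : ℝ} (hK : HasInnerBall K r)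
    {x : Eucl n} (hx : x ∈ frontier K) : ‖weingartenCLM K x‖ ≤ 2 / r := by
  have hr := hK.pos
  refine ContinuousLinearMap.opNorm_le_bound _ (by positivity) fun v => ?_
  change ‖weingarten K x v‖ ≤ _
  by_cases h : ∃ A, IsWeingartenMap K x (outerNormal K x) A
  · obtain ⟨A, hA⟩ := h
    rw [hK.weingarten_eq hx hA]
    exact hK.norm_weingartenMap_le hx (hK.body.outerNormal_spec hx) hA v
  · rw [weingarten, dif_neg h, LinearMap.zero_apply, norm_zero]
    positivity

/-! ### Finite area of the boundary -/

/-- The nearest point map of a convex set, seen on outward normal rays, is a contraction. -/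
theorem norm_sub_le_of_isOuterUnitNormal {K : Set (Eucl n)} {x x' N N' : Eucl n} {s s' : ℝ}
    (hx : x ∈ K) (hx' : x' ∈ K) (hN : IsOuterUnitNormal K x N) (hN' : IsOuterUnitNormal K x' N')
    (hs : 0 ≤ s) (hs' : 0 ≤ s') : ‖x - x'‖ ≤ ‖(x + s • N) - (x' + s' • N')‖ := by
  have h1 := mul_nonpos_of_nonneg_of_nonpos hs (hN.2 x' hx')
  have h2 := mul_nonpos_of_nonneg_of_nonpos hs' (hN'.2 x hx)
  set z := (x + s • N) - (x' + s' • N') with hz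
  have e : ⟪x - x', z⟫ = ‖x - x'‖ ^ 2 - s * ⟪x' - x, N⟫ - s' * ⟪x - x', N'⟫ := by
    have : z = (x - x') + s • N - s' • N' := by rw [hz]; module
    rw [this, inner_sub_right, inner_add_right, real_inner_self_eq_norm_sq, inner_smul_right,
      inner_smul_right, ← neg_sub x' x, inner_neg_left, inner_neg_left, norm_neg]
    ring
  have h3 := real_inner_le_norm (x - x') z
  rcases (norm_nonneg (x - x')).eq_or_lt with h | h
  · rw [← h]; exact norm_nonneg _
  · nlinarith

/-- A parametrized face of the cube of radius `M`. -/
def cubeFace {d : ℕ} (i : Fin (d + 1)) (c : ℝ) (u : Fin d → ℝ) : Eucl (d + 1) :=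
  WithLp.toLp 2 (i.insertNth c u)

theorem lipschitzWith_cubeFace {d : ℕ} (i : Fin (d + 1)) (c : ℝ) :
    ∃ C, LipschitzWith C (cubeFace i c) := by
  have h1 : LipschitzWith 1 fun u : Fin d → ℝ => (i.insertNth c u : Fin (d + 1) → ℝ) := by
    refine LipschitzWith.of_dist_le_mul fun u v => ?_
    rw [NNReal.coe_one, one_mul, dist_pi_le_iff dist_nonneg]
    intro j
    refine Fin.succAboveCases i ?_ (fun l => ?_) j
    · simp
    · simpa using dist_le_pi_dist u v l
  exact ⟨_, (PiLp.lipschitzWith_toLp 2 fun _ : Fin (d + 1) => ℝ).comp h1⟩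

/-- A face is a Lipschitz image of a box in `Fin d → ℝ`, where `μH[d]` is Lebesgue measure. -/
theorem hausdorffMeasure_cubeFace_lt_top {d : ℕ} (i : Fin (d + 1)) (c M : ℝ) :
    (μH[(d : ℝ)] : MeasureTheory.Measure (Eucl (d + 1)))
      (cubeFace i c '' Set.Icc (fun _ => -M) (fun _ => M)) < ⊤ := by
  obtain ⟨C, hC⟩ := lipschitzWith_cubeFace i c
  refine (hC.hausdorffMeasure_image_le (Nat.cast_nonneg d) _).trans_lt ?_
  have h : (μH[(d : ℝ)] : MeasureTheory.Measure (Fin d → ℝ)) = MeasureTheory.volume := by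
    simpa using MeasureTheory.hausdorffMeasure_pi_real (ι := Fin d)
  rw [h]
  exact ENNReal.mul_lt_top (ENNReal.rpow_lt_top_of_nonneg (Nat.cast_nonneg d) ENNReal.coe_ne_top)
    isCompact_Icc.measure_lt_top

/-- The boundary of the cube of radius `M`. -/
def cubeBoundary (d : ℕ) (M : ℝ) : Set (Eucl (d + 1)) :=
  ⋃ i : Fin (d + 1), (cubeFace i M '' Set.Icc (fun _ => -M) (fun _ => M)) ∪
    (cubeFace i (-M) '' Set.Icc (fun _ => -M) (fun _ => M))

theorem hausdorffMeasure_cubeBoundary_lt_top (d : ℕ) (M : ℝ) :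
    (μH[(d : ℝ)] : MeasureTheory.Measure (Eucl (d + 1))) (cubeBoundary d M) < ⊤ := by
  refine (MeasureTheory.measure_iUnion_le _).trans_lt ?_
  rw [tsum_fintype]
  refine ENNReal.sum_lt_top.2 fun i _ => ?_
  exact (MeasureTheory.measure_union_le _ _).trans_lt (ENNReal.add_lt_top.2
    ⟨hausdorffMeasure_cubeFace_lt_top i M M, hausdorffMeasure_cubeFace_lt_top i (-M) M⟩)

theorem mem_cubeBoundary {d : ℕ} {M : ℝ} {z : Eucl (d + 1)}
    (hz : ‖(WithLp.ofLp z : Fin (d + 1) → ℝ)‖ = M) : z ∈ cubeBoundary d M := by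
  obtain ⟨i, -, hi⟩ := Finset.exists_mem_eq_sup' (s := Finset.univ) Finset.univ_nonempty
    (fun i => ‖z i‖)
  have hi' : |z i| = M := by
    rw [← hz]
    refine le_antisymm (norm_le_pi_norm (WithLp.ofLp z) i)
      ((pi_norm_le_iff_of_nonneg (norm_nonneg (z i))).2 fun j => ?_)
    rw [← hi]
    exact Finset.le_sup' (fun i => ‖z i‖) (Finset.mem_univ j)
  have hb : ∀ j, |z j| ≤ M := fun j => by rw [← hz]; exact norm_le_pi_norm (WithLp.ofLp z) j
  have hu : (fun l => z (i.succAbove l)) ∈ Set.Icc (fun _ : Fin d => -M) (fun _ => M) :=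
    ⟨fun l => (abs_le.1 (hb _)).1, fun l => (abs_le.1 (hb _)).2⟩
  have hface : ∀ c, z i = c → cubeFace i c (fun l => z (i.succAbove l)) = z := by
    rintro _ rfl
    ext j
    refine Fin.succAboveCases i ?_ (fun l => ?_) j <;> simp [cubeFace]
  rw [cubeBoundary, Set.mem_iUnion]
  refine ⟨i, ?_⟩
  rcases abs_choice (z i) with h | h
  · exact Or.inl ⟨_, hu, hface _ (by rw [← hi', h])⟩
  · exact Or.inr ⟨_, hu, hface _ (by rw [← hi', h, neg_neg])⟩

theorem exists_add_smul_mem_cubeBoundary {d : ℕ} {M : ℝ} {x N : Eucl (d + 1)} (hN : ‖N‖ = 1)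
    (hx : ‖x‖ ≤ M) : ∃ s : ℝ, 0 ≤ s ∧ x + s • N ∈ cubeBoundary d M := by
  have hM : 0 ≤ M := (norm_nonneg _).trans hx
  have hxi : ∀ i, |x i| ≤ M := fun i => (PiLp.norm_apply_le x i).trans hx
  obtain ⟨j, hj⟩ : ∃ j, N j ≠ 0 := by
    by_contra! h
    have : N = 0 := by ext j; exact h j
    rw [this, norm_zero] at hN
    exact zero_ne_one hN
  let g : ℝ → ℝ := fun s => ‖(WithLp.ofLp (x + s • N) : Fin (d + 1) → ℝ)‖
  have hg : Continuous g := by fun_prop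
  have hj' : 0 < |N j| := abs_pos.2 hj
  -- By time `T` the `j`-th coordinate has moved by `2 M` from a start in `[-M, M]`, so the sup norm
  -- has reached `M`.
  set T := 2 * M / |N j| with hT
  have hT0 : 0 ≤ T := by positivity
  have h0 : g 0 ≤ M := by
    refine (pi_norm_le_iff_of_nonneg hM).2 fun i => ?_
    simpa using hxi i
  have h1 : M ≤ g T := by
    refine le_trans ?_ (norm_le_pi_norm (WithLp.ofLp (x + T • N)) j)
    have e : |T * N j| = 2 * M := by
      rw [abs_mul, abs_of_nonneg hT0, hT, div_mul_cancel₀ _ hj'.ne']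
    have := abs_sub_abs_le_abs_sub (T * N j) (-x j)
    rw [abs_neg, e, sub_neg_eq_add] at this
    have h2 := hxi j
    simp only [PiLp.add_apply, PiLp.smul_apply, smul_eq_mul, Real.norm_eq_abs]
    rw [add_comm]
    linarith
  obtain ⟨s, hs, hgs⟩ := intermediate_value_Icc hT0 hg.continuousOn ⟨h0, h1⟩
  exact ⟨s, hs.1, mem_cubeBoundary hgs⟩

/-- Outward normal rays reach the surface of a cube around `K`; sending each hit point back to its
foot is a 1-Lipschitz map onto the frontier. -/
theorem IsBody.hausdorffMeasure_frontier_lt_top {d : ℕ} {K : Set (Eucl (d + 1))} (hK : IsBody K) :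
    (μH[(d : ℝ)] : MeasureTheory.Measure (Eucl (d + 1))) (frontier K) < ⊤ := by
  obtain ⟨M, hM⟩ := hK.1.isBounded.exists_norm_le
  let S : Set (Eucl (d + 1)) := {z ∈ cubeBoundary d M | ∃ x ∈ frontier K, ∃ N,
    IsOuterUnitNormal K x N ∧ ∃ s : ℝ, 0 ≤ s ∧ x + s • N = z}
  have hS : ∀ z : Eucl (d + 1), ∃ x, z ∈ S → x ∈ frontier K ∧ ∃ N, IsOuterUnitNormal K x N ∧
      ∃ s : ℝ, 0 ≤ s ∧ x + s • N = z := by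
    intro z
    by_cases hz : z ∈ S
    · obtain ⟨-, x, hx, h⟩ := hz
      exact ⟨x, fun _ => ⟨hx, h⟩⟩
    · exact ⟨0, fun h => absurd h hz⟩
  choose P hP using hS
  have hlip : LipschitzOnWith 1 P S := by
    refine LipschitzOnWith.of_dist_le_mul fun z hz z' hz' => ?_
    obtain ⟨hx, N, hN, s, hs, e⟩ := hP z hz
    obtain ⟨hx', N', hN', s', hs', e'⟩ := hP z' hz'
    have := norm_sub_le_of_isOuterUnitNormal (hK.frontier_subset hx) (hK.frontier_subset hx')
      hN hN' hs hs'
    rw [e, e'] at this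
    rwa [NNReal.coe_one, one_mul, dist_eq_norm, dist_eq_norm]
  have hsub : frontier K ⊆ P '' S := by
    intro x hx
    obtain ⟨N, hN⟩ := hK.exists_isOuterUnitNormal hx
    obtain ⟨s, hs, hmem⟩ := exists_add_smul_mem_cubeBoundary hN.1 (hM x (hK.frontier_subset hx))
    have hz : x + s • N ∈ S := ⟨hmem, x, hx, N, hN, s, hs, rfl⟩
    refine ⟨_, hz, ?_⟩
    -- The chosen foot is `x` itself: two feet of the same point are at distance `0` by the
    -- contraction estimate.
    obtain ⟨hx', N', hN', s', hs', e'⟩ := hP _ hz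
    have := norm_sub_le_of_isOuterUnitNormal (hK.frontier_subset hx') (hK.frontier_subset hx)
      hN' hN hs' hs
    rw [e', sub_self, norm_zero] at this
    exact sub_eq_zero.1 (norm_le_zero_iff.1 this)
  refine (MeasureTheory.measure_mono hsub).trans_lt
    ((hlip.hausdorffMeasure_image_le (Nat.cast_nonneg d)).trans_lt ?_)
  refine ENNReal.mul_lt_top (ENNReal.rpow_lt_top_of_nonneg (Nat.cast_nonneg d)
    ENNReal.coe_ne_top) ?_
  exact (MeasureTheory.measure_mono (Set.sep_subset _ _)).trans_lt
    (hausdorffMeasure_cubeBoundary_lt_top d M)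

theorem IsBody.isFiniteMeasure_boundaryMeasure {K : Set (Eucl n)} (hK : IsBody K) :
    MeasureTheory.IsFiniteMeasure (boundaryMeasure K) := by
  refine ⟨?_⟩
  rw [boundaryMeasure, MeasureTheory.Measure.restrict_apply_univ]
  cases n with
  | zero =>
    have : K = Set.univ := by
      obtain ⟨a, ha⟩ := hK.2.2
      exact Set.eq_univ_of_forall fun y => Subsingleton.elim a y ▸ interior_subset ha
    rw [this, frontier_univ, MeasureTheory.measure_empty]
    exact ENNReal.zero_lt_top
  | succ d =>
    rw [MeasureTheory.Measure.euclideanHausdorffMeasure_def, MeasureTheory.Measure.smul_apply,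
      ENNReal.smul_def, smul_eq_mul]
    exact ENNReal.mul_lt_top ENNReal.coe_lt_top hK.hausdorffMeasure_frontier_lt_top

/-! ### Integrability -/

/-- The normalized elementary symmetric function `H_j` of the eigenvalues of a map. -/
def normalizedESymm (j : ℕ) (A : Eucl n →L[ℝ] Eucl n) : ℝ :=
  ((n - 1).choose j : ℝ)⁻¹ * ((-1) ^ j * (A : Eucl n →ₗ[ℝ] Eucl n).charpoly.coeff (n - j))

theorem continuous_normalizedESymm (j : ℕ) : Continuous (normalizedESymm (n := n) j) :=
  continuous_const.mul (continuous_const.mul (continuous_charpoly_coeff _))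

theorem symCurv_eq_normalizedESymm (K : Set (Eucl n)) (x : Eucl n) {j : ℕ} (hj : j ≤ n) :
    symCurv K j x = normalizedESymm j (weingartenCLM K x) := by
  rw [symCurv_eq_coeff K x hj, normalizedESymm, coe_weingartenCLM]

/-- The curvature factor of the integrand as a function of the Weingarten map. -/
def curvatureFactor (m : ℕ) (A : Eucl n →L[ℝ] Eucl n) : ℝ :=
  normalizedESymm (n - 1) A ^ ((1 : ℝ) / (n + 1)) *
    ∑ i ∈ indices n m, coeff n 1 i *
      ∏ j : Fin (n - 1),
        ((n - 1).choose ((j : ℕ) + 1) : ℝ) ^ i j * normalizedESymm ((j : ℕ) + 1) A ^ i j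

theorem continuous_curvatureFactor (m : ℕ) : Continuous (curvatureFactor (n := n) m) := by
  refine Continuous.mul ?_ ?_
  · exact (continuous_normalizedESymm _).rpow_const fun _ => Or.inr (by positivity)
  · exact continuous_finsetSum _ fun i _ => continuous_const.mul
      (continuous_finsetProd _ fun j _ => continuous_const.mul
        ((continuous_normalizedESymm _).pow _))

theorem steinerIntegrand_one_eq (m k : ℕ) (K : Set (Eucl n)) (x : Eucl n) :
    steinerIntegrand 1 m k K x =
      ⟪x, outerNormal K x⟫ ^ ((m : ℝ) - k) * curvatureFactor m (weingartenCLM K x) := by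
  have hj : ∀ j : Fin (n - 1), symCurv K ((j : ℕ) + 1) x =
      normalizedESymm ((j : ℕ) + 1) (weingartenCLM K x) := fun j =>
    symCurv_eq_normalizedESymm K x (by omega)
  simp only [steinerIntegrand, curvatureFactor, hj,
    symCurv_eq_normalizedESymm K x (show n - 1 ≤ n by omega), sub_self, mul_zero, zero_div,
    add_zero, mul_assoc]

/-- The integrand is bounded and the measure finite: the support factor is continuous on the compact
frontier, since its base is nonzero or its exponent nonnegative, and the curvature factor is
continuous on the compact ball `‖A‖ ≤ 2 / r`. -/
theorem HasInnerBall.integrable_steinerIntegrand {K : Set (Eucl n)} {r : ℝ}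
    (hK : HasInnerBall K r) {m k : ℕ}
    (h : ∀ x ∈ frontier K, ⟪x, outerNormal K x⟫ ≠ 0 ∨ k ≤ m) :
    MeasureTheory.Integrable (steinerIntegrand 1 m k K) (boundaryMeasure K) := by
  have := hK.body.isFiniteMeasure_boundaryMeasure
  have hcompact : IsCompact (frontier K) :=
    hK.body.1.of_isClosed_subset isClosed_frontier hK.body.frontier_subset
  have hcont : ContinuousOn (fun x => ⟪x, outerNormal K x⟫ ^ ((m : ℝ) - k)) (frontier K) := by
    refine (continuousOn_id.inner hK.continuousOn_outerNormal).rpow_const fun x hx => ?_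
    exact (h x hx).imp id fun h => sub_nonneg.2 (Nat.cast_le.2 h)
  obtain ⟨C, hC⟩ := hcompact.exists_bound_of_continuousOn hcont
  obtain ⟨D, hD⟩ := (isCompact_closedBall (0 : Eucl n →L[ℝ] Eucl n)
    (2 / r)).exists_bound_of_continuousOn (continuous_curvatureFactor m).continuousOn
  have hmeas : MeasureTheory.AEStronglyMeasurable (steinerIntegrand 1 m k K)
      (boundaryMeasure K) := by
    have e : steinerIntegrand 1 m k K = fun x => ⟪x, outerNormal K x⟫ ^ ((m : ℝ) - k) *
        curvatureFactor m (weingartenCLM K x) := funext (steinerIntegrand_one_eq m k K)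
    rw [e]
    exact (hcont.aestronglyMeasurable isClosed_frontier.measurableSet).mul
      ((continuous_curvatureFactor m).measurable.comp_aemeasurable
        hK.aemeasurable_weingartenCLM).aestronglyMeasurable
  refine MeasureTheory.Integrable.of_bound hmeas (C * D) ?_
  rw [boundaryMeasure]
  filter_upwards [MeasureTheory.ae_restrict_mem isClosed_frontier.measurableSet] with x hx
  rw [steinerIntegrand_one_eq, norm_mul]
  have h1 := hC x hx
  have h2 := hD _ (mem_closedBall_zero_iff.2 (hK.norm_weingartenCLM_le hx))
  exact mul_le_mul h1 h2 (norm_nonneg _) ((norm_nonneg _).trans h1)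

theorem IsOuterUnitNormal.inner_pos {K : Set (Eucl n)} (h0 : 0 ∈ interior K) {x N : Eucl n}
    (hN : IsOuterUnitNormal K x N) : 0 < ⟪x, N⟫ := by
  obtain ⟨ε, hε, hb⟩ := Metric.isOpen_iff.1 isOpen_interior _ h0
  have hm : (ε / 2) • N ∈ K := by
    apply interior_subset (hb _)
    rw [mem_ball_zero_iff, norm_smul, hN.1, Real.norm_eq_abs, abs_of_pos (by positivity)]
    linarith
  have := hN.2 _ hm
  rw [inner_sub_left, inner_smul_left, real_inner_self_eq_norm_sq, hN.1] at this
  simp at this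
  linarith

/-! ### The case `p = 1`, rigid motions and dilations -/

theorem quermass_one (k : ℕ) (K : Set (Eucl n)) : quermass 1 k K = steinerCoeff 1 k k K := by
  rw [quermass, Finset.sum_range_succ, Finset.sum_eq_zero, Nat.sub_self, Ring.choose_zero_right,
    one_mul, zero_add]
  intro m hm
  -- For `m < k` the coefficient is `binom(0, k - m)` with positive lower entry.
  rw [sub_self, mul_zero, zero_div, Ring.choose_zero_pos _ (by
    have := Finset.mem_range.1 hm
    omega), zero_mul]

/-- A rigid motion as a similarity. -/
def Similarity.ofIsometry (g : Eucl n ≃ᵃⁱ[ℝ] Eucl n) : Similarity n where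
  t := 1
  pos := one_pos
  L := g.linearIsometryEquiv
  b := g 0

theorem Similarity.ofIsometry_image (g : Eucl n ≃ᵃⁱ[ℝ] Eucl n) (K : Set (Eucl n)) :
    (Similarity.ofIsometry g).toHomeomorph '' K = g '' K := by
  refine Set.image_congr fun x _ => ?_
  have h := g.map_vadd 0 x
  rw [vadd_eq_add, vadd_eq_add, add_zero] at h
  rw [h, toHomeomorph_apply]
  simp [ofIsometry]

/-- A dilation as a similarity. -/
def Similarity.ofDilation (t : ℝ) (ht : 0 < t) : Similarity n where
  t := t
  pos := ht
  L := LinearIsometryEquiv.refl ℝ _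
  b := 0

theorem Similarity.ofDilation_image (t : ℝ) (ht : 0 < t) (K : Set (Eucl n)) :
    (Similarity.ofDilation t ht).toHomeomorph '' K = t • K := by
  rw [← Set.image_smul]
  refine Set.image_congr fun x _ => ?_
  rw [toHomeomorph_apply]
  simp [ofDilation]

/-- `(n-1) - (n-1)/(n+1) = n(n-1)/(n+1)`; `1 ≤ n` identifies the truncated `n - 1` with the real
one. -/
theorem scaling_exponent {t : ℝ} (ht : 0 < t) (n k : ℕ) (hn : 1 ≤ n) :
    t ^ (n - 1) * ((t⁻¹ ^ (n - 1)) ^ ((1 : ℝ) / (n + 1)) * t⁻¹ ^ k) =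
      t ^ ((n : ℝ) * ((n - 1) / (n + 1)) - k) := by
  obtain ⟨d, rfl⟩ := Nat.exists_eq_add_of_le' hn
  have e1 : t⁻¹ ^ (d + 1 - 1) = t ^ (-(d : ℝ)) := by
    rw [Real.rpow_neg ht.le, Real.rpow_natCast, inv_pow, Nat.add_sub_cancel]
  have e2 : t⁻¹ ^ k = t ^ (-(k : ℝ)) := by
    rw [Real.rpow_neg ht.le, Real.rpow_natCast, inv_pow]
  have e3 : t ^ (d + 1 - 1) = t ^ (d : ℝ) := by rw [Real.rpow_natCast, Nat.add_sub_cancel]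
  rw [e1, e2, e3, ← Real.rpow_mul ht.le, ← Real.rpow_add ht, ← Real.rpow_add ht]
  congr 1
  push_cast
  have : (d : ℝ) + 1 + 1 ≠ 0 := by positivity
  field_simp
  ring

theorem steinerCoeff_zero_dim (p : ℝ) (m k : ℕ) (K : Set (Eucl 0)) : steinerCoeff p m k K = 0 := by
  have : frontier K = ∅ := by
    rcases K.eq_empty_or_nonempty with rfl | ⟨a, ha⟩
    · exact frontier_empty
    · have h : K = Set.univ := Set.eq_univ_of_forall fun y => Subsingleton.elim a y ▸ ha
      rw [h, frontier_univ]
  rw [steinerCoeff, boundaryMeasure, this, MeasureTheory.Measure.restrict_empty,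
    MeasureTheory.integral_zero_measure]

theorem HasInnerBall.steinerCoeff_dilation {K : Set (Eucl n)} {r : ℝ} (hK : HasInnerBall K r)
    (k : ℕ) {t : ℝ} (ht : 0 < t) :
    steinerCoeff 1 k k (t • K) =
      t ^ ((n : ℝ) * ((n - 1) / (n + 1)) - k) * steinerCoeff 1 k k K := by
  rcases Nat.eq_zero_or_pos n with rfl | hn
  · rw [steinerCoeff_zero_dim, steinerCoeff_zero_dim, mul_zero]
  · rw [← Similarity.ofDilation_image t ht, Similarity.steinerCoeff_image _ hK,
      ← scaling_exponent ht n k hn]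
    rfl

theorem HasInnerBall.steinerCoeff_isometry {K : Set (Eucl n)} {r : ℝ} (hK : HasInnerBall K r)
    (k : ℕ) (g : Eucl n ≃ᵃⁱ[ℝ] Eucl n) :
    steinerCoeff 1 k k (g '' K) = steinerCoeff 1 k k K := by
  rw [← Similarity.ofIsometry_image g, Similarity.steinerCoeff_image _ hK]
  simp [Similarity.ofIsometry]

end LpSteiner

end

theorem mainTheorem7 (n : ℕ) (K : Set (LpSteiner.Eucl n)) (hK : K ∈ LpSteiner.rollingClass n)
    (k : ℕ) :
    -- all the integrals in `V^1_k(K)` are finite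
    (0 ∈ interior K → ∀ m ≤ k, MeasureTheory.Integrable
      (LpSteiner.steinerIntegrand 1 m k K) (LpSteiner.boundaryMeasure K)) ∧
    -- `V^1_k = W_{k,k}`
    LpSteiner.quermass 1 k K = LpSteiner.steinerCoeff 1 k k K ∧
    -- invariance under rigid motions (translations, rotations, reflections)
    (∀ g : LpSteiner.Eucl n ≃ᵃⁱ[ℝ] LpSteiner.Eucl n,
      MeasureTheory.Integrable (LpSteiner.steinerIntegrand 1 k k (g '' K))
        (LpSteiner.boundaryMeasure (g '' K)) ∧
      LpSteiner.steinerCoeff 1 k k (g '' K) = LpSteiner.steinerCoeff 1 k k K ∧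
      LpSteiner.quermass 1 k (g '' K) = LpSteiner.quermass 1 k K) ∧
    -- homogeneity of degree `n (n-1)/(n+1) - k`
    (∀ t : ℝ, 0 < t →
      LpSteiner.steinerCoeff 1 k k (t • K) =
        t ^ ((n : ℝ) * ((n - 1) / (n + 1)) - k) * LpSteiner.steinerCoeff 1 k k K ∧
      LpSteiner.quermass 1 k (t • K) =
        t ^ ((n : ℝ) * ((n - 1) / (n + 1)) - k) * LpSteiner.quermass 1 k K) := by
  obtain ⟨r, hr⟩ := LpSteiner.HasInnerBall.of_mem_rollingClass hK
  refine ⟨fun h0 m _ => ?_, LpSteiner.quermass_one k K, fun g => ⟨?_, ?_, ?_⟩,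
    fun t ht => ⟨?_, ?_⟩⟩
  · exact hr.integrable_steinerIntegrand fun x hx =>
      Or.inl ((hr.body.outerNormal_spec hx).inner_pos h0).ne'
  · rw [← LpSteiner.Similarity.ofIsometry_image g]
    -- Integrability is proved for `K` and transported, as `g '' K` need not contain the origin.
    exact LpSteiner.Similarity.integrable_image _ hr k
      (hr.integrable_steinerIntegrand fun _ _ => Or.inr le_rfl)
  · exact hr.steinerCoeff_isometry k g
  · rw [LpSteiner.quermass_one, LpSteiner.quermass_one, hr.steinerCoeff_isometry k g]
  · exact hr.steinerCoeff_dilation k ht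
  · rw [LpSteiner.quermass_one, LpSteiner.quermass_one, hr.steinerCoeff_dilation k ht]
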